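/- Let $\mathbf{FdHilb}$ be the category of finite-dimensional complex Hilbert spaces and linear maps, with the symmetric monoidal structure given by the orthogonal direct sum $\oplus$ (unit $\{0\}$). Let $\mathbf{FdContraction}$, $\mathbf{FdIsometry}$, $\mathbf{FdUnitary}$ be its symmetric monoidal subcategories with the same objects and with morphisms the linear maps $f$ satisfying, respectively, $\|f(a)\|\le\|a\|$ for all $a$; $\|f(a)\|=\|a\|$ for all $a$; and $f$ a surjective isometry. For $f\colon A\oplus U\to B\oplus U$ with matrix components $f_{BA},f_{BU},f_{UA},f_{UU}$, the execution formula is the partial operation $$\mathrm{ex}^U(f)=\Sigma\bigl(\{f_{BA}\}\uplus\{f_{BU}\,f_{UU}^{\,n}\,f_{UA}\}_{n\in\mathbb N}\bigr)\colon A\to B,$$ where $\Sigma$ of a family of linear maps is the limit, in the operator norm, of the net of its finite partial sums, and is undefined if this limit does not exist; in $\mathbf{FdContraction}$ it is moreover required that the limit be a contraction. For a morphism $f\colon A\oplus U\to B\oplus U$ of $\mathbf{FdIsometry}$ (respectively $\mathbf{FdUnitary}$), let $\widehat{\mathrm{ex}}^U(f)=\mathrm{ex}^U(f)$ (computed in $\mathbf{FdContraction}$)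 if this is defined and is an isometry (respectively unitary), and let $\widehat{\mathrm{ex}}^U(f)$ be undefined otherwise. A family of partial maps $T^U_{A,B}\colon \mathcal C(A\otimes U,B\otimes U)\rightharpoonup\mathcal C(A,B)$ on a symmetric monoidal category $(\mathcal C,\otimes,I)$ is a total trace if every $T^U_{A,B}$ is defined everywhere and, suppressing associators: - (naturality) $h\circ T^U(f)\circ g=T^U((h\otimes\mathrm{id}_U)\circ f\circ(g\otimes\mathrm{id}_U))$ for $f\colon A\otimes U\to B\otimes U$, $g\colon A'\to A$, $h\colon B\to B'$; - (dinaturality) $T^U((\mathrm{id}_B\otimes g)\circ f)=T^{U'}(f\circ(\mathrm{id}_A\otimes g))$ for $f\colon A\otimes U\to B\otimes U'$, $g\colon U'\to U$; - (superposing) $g\otimes T^U(f)=T^U(g\otimes f)$ for $f\colon A\otimes U\to B\otimes U$, $g\colon C\to D$; - (vanishing I) $T^I(f)=\rho_B\circ f\circ\rho_A^{-1}$ for $f\colon A\otimes I\to B\otimes I$; - (vanishing II) $T^U(T^V(f))=T^{U\otimes V}(f)$ for $f\colon A\otimes U\otimes V\to B\otimes U\otimes V$; - (yanking) $T^U(\sigma_{U,U})=\mathrm{id}_U$,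 where $\sigma$ is the symmetry. Then $(\mathbf{FdIsometry},\oplus,\widehat{\mathrm{ex}})$ is totally traced, that is, $\widehat{\mathrm{ex}}$ is a total trace on $\mathbf{FdIsometry}$ (in particular $\mathrm{ex}^U(f)$ is defined and is an isometry for every isometry $f\colon A\oplus U\to B\oplus U$). Similarly, $(\mathbf{FdUnitary},\oplus,\widehat{\mathrm{ex}})$ is totally traced (in particular $\mathrm{ex}^U(f)$ is defined and is unitary for every unitary $f\colon A\oplus U\to B\oplus U$). -/

import Mathlib

open CategoryTheory MonoidalCategory

universe u v w

/-! ### Traces on symmetric monoidal categories -/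

section Traced

variable {C : Type w} [Category.{v} C] [MonoidalCategory C]

/-- A family of total maps `Tr : C(A ⊗ U, B ⊗ U) → C(A, B)` is a trace, that is, makes the symmetric
monoidal category `C` a traced monoidal category (axioms of Joyal, Street and Verity). Composition
is written in diagrammatic order. -/
structure IsTrace [SymmetricCategory C]
    (Tr : ∀ {A B U : C}, (A ⊗ U ⟶ B ⊗ U) → (A ⟶ B)) : Prop where
  naturality : ∀ {A A' B B' U : C} (f : A ⊗ U ⟶ B ⊗ U) (g : A' ⟶ A) (h : B ⟶ B'),
    g ≫ Tr f ≫ h = Tr ((g ⊗ₘ 𝟙 U) ≫ f ≫ (h ⊗ₘ 𝟙 U))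
  dinaturality : ∀ {A B U U' : C} (f : A ⊗ U ⟶ B ⊗ U') (g : U' ⟶ U),
    Tr (f ≫ (𝟙 B ⊗ₘ g)) = Tr ((𝟙 A ⊗ₘ g) ≫ f)
  superposing : ∀ {A B C' D U : C} (f : A ⊗ U ⟶ B ⊗ U) (g : C' ⟶ D),
    g ⊗ₘ Tr f = Tr ((α_ C' A U).hom ≫ (g ⊗ₘ f) ≫ (α_ D B U).inv)
  vanishing_one : ∀ {A B : C} (f : A ⊗ 𝟙_ C ⟶ B ⊗ 𝟙_ C),
    Tr f = (ρ_ A).inv ≫ f ≫ (ρ_ B).hom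
  vanishing_two : ∀ {A B U V : C} (f : A ⊗ (U ⊗ V) ⟶ B ⊗ (U ⊗ V)),
    Tr (Tr ((α_ A U V).hom ≫ f ≫ (α_ B U V).inv)) = Tr f
  yanking : ∀ U : C, Tr (β_ U U).hom = 𝟙 U

/-- A family of partial maps `T : C(A ⊗ U, B ⊗ U) ⇀ C(A, B)` makes `C` totally traced: every
`T f` is defined, and the resulting family of total maps is a trace. -/
def IsTotallyTraced (C : Type w) [Category.{v} C] [MonoidalCategory C] [SymmetricCategory C]
    (T : ∀ {A B U : C}, (A ⊗ U ⟶ B ⊗ U) → Part (A ⟶ B)) : Prop :=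
  ∃ Tr : ∀ {A B U : C}, (A ⊗ U ⟶ B ⊗ U) → (A ⟶ B),
    IsTrace Tr ∧ ∀ {A B U : C} (f : A ⊗ U ⟶ B ⊗ U), T f = Part.some (Tr f)

end Traced

/-- Restriction of a partially defined morphism along a faithful functor `F`: its value is the unique
`g` such that `F.map g` is the value of `t`, and it is undefined if there is no such `g`. -/
noncomputable def restrictPart {C : Type*} {D : Type*} [Category* C] [Category* D] (F : D ⥤ C)
    [F.Faithful] {X Y : D} (t : Part (F.obj X ⟶ F.obj Y)) : Part (X ⟶ Y) :=
  ⟨∃ g : X ⟶ Y, F.map g ∈ t, fun h => h.choose⟩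

theorem mem_restrictPart {C : Type*} {D : Type*} [Category* C] [Category* D] (F : D ⥤ C)
    [F.Faithful] {X Y : D} (t : Part (F.obj X ⟶ F.obj Y)) (g : X ⟶ Y) :
    g ∈ restrictPart F t ↔ F.map g ∈ t := by
  constructor
  · rintro ⟨h, rfl⟩
    exact h.choose_spec
  · intro hg
    have h : ∃ g : X ⟶ Y, F.map g ∈ t := ⟨g, hg⟩
    exact ⟨h, F.map_injective (Part.mem_unique h.choose_spec hg)⟩

/-- The inclusion of a wide subcategory into a larger one. -/
def wideInclusionOfLE {C : Type*} [Category* C] {P Q : MorphismProperty C} [P.IsMultiplicative]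
    [Q.IsMultiplicative] (h : P ≤ Q) : WideSubcategory P ⥤ WideSubcategory Q where
  obj X := ⟨X.obj⟩
  map f := ⟨f.hom, h _ f.property⟩

instance {C : Type*} [Category* C] {P Q : MorphismProperty C} [P.IsMultiplicative]
    [Q.IsMultiplicative] (h : P ≤ Q) : (wideInclusionOfLE h).Faithful where
  map_injective {X Y f g} e := by
    have e' : ((wideInclusionOfLE h).map f).hom = ((wideInclusionOfLE h).map g).hom := by rw [e]
    exact WideSubcategory.hom_ext P e'

/-! ### Finite-dimensional Hilbert spaces with the orthogonal direct sum -/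

/-- A finite-dimensional complex Hilbert space. -/
structure FdHilb : Type (u + 1) where
  carrier : Type u
  [normedAddCommGroup : NormedAddCommGroup carrier]
  [innerProductSpace : InnerProductSpace ℂ carrier]
  [finiteDimensional : FiniteDimensional ℂ carrier]

namespace FdHilb

attribute [instance] normedAddCommGroup innerProductSpace finiteDimensional

instance : CoeSort FdHilb.{u} (Type u) := ⟨carrier⟩

/-- Morphisms are (bounded) linear maps. -/
@[ext]
structure Hom (A B : FdHilb.{u}) where
  toCLM : A →L[ℂ] B

instance : Category FdHilb.{u} where
  Hom := Hom
  id A := ⟨ContinuousLinearMap.id ℂ A⟩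
  comp f g := ⟨g.toCLM ∘L f.toCLM⟩

@[ext]
theorem hom_ext {A B : FdHilb.{u}} {f g : A ⟶ B} (h : ∀ a, f.toCLM a = g.toCLM a) : f = g :=
  Hom.ext (ContinuousLinearMap.ext h)

@[simp]
theorem id_apply {A : FdHilb.{u}} (a : A) : (𝟙 A : A ⟶ A).toCLM a = a := rfl

@[simp]
theorem comp_apply {A B C : FdHilb.{u}} (f : A ⟶ B) (g : B ⟶ C) (a : A) :
    (f ≫ g).toCLM a = g.toCLM (f.toCLM a) := rfl

/-- The isomorphism given by a linear isometric equivalence. -/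
def isoOfLIE {A B : FdHilb.{u}} (e : A ≃ₗᵢ[ℂ] B) : A ≅ B where
  hom := ⟨(e.toContinuousLinearEquiv : A →L[ℂ] B)⟩
  inv := ⟨(e.symm.toContinuousLinearEquiv : B →L[ℂ] A)⟩
  hom_inv_id := hom_ext fun a => e.symm_apply_apply a
  inv_hom_id := hom_ext fun b => e.apply_symm_apply b

@[simp]
theorem isoOfLIE_hom_apply {A B : FdHilb.{u}} (e : A ≃ₗᵢ[ℂ] B) (a : A) :
    (isoOfLIE e).hom.toCLM a = e a := rfl

@[simp]
theorem isoOfLIE_inv_apply {A B : FdHilb.{u}} (e : A ≃ₗᵢ[ℂ] B) (b : B) :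
    (isoOfLIE e).inv.toCLM b = e.symm b := rfl

/-- The direct sum, with inner product `⟪(a, b), (a', b')⟫ = ⟪a, a'⟫ + ⟪b, b'⟫`. -/
noncomputable abbrev dsum (A B : FdHilb.{u}) : FdHilb.{u} := ⟨WithLp 2 (A × B)⟩

/-- The linear map `(a, b) ↦ (f a, g b)`. -/
noncomputable def dsumMap {A B C D : FdHilb.{u}} (f : A ⟶ C) (g : B ⟶ D) : dsum A B ⟶ dsum C D :=
  ⟨LinearMap.toContinuousLinearMap
    ((f.toCLM.toLinearMap.prodMap g.toCLM.toLinearMap).withLpMap 2)⟩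

noncomputable instance : MonoidalCategoryStruct FdHilb.{u} where
  tensorObj A B := dsum A B
  whiskerLeft A _ _ g := dsumMap (𝟙 A) g
  whiskerRight f B := dsumMap f (𝟙 B)
  tensorHom f g := dsumMap f g
  tensorUnit := ⟨PUnit.{u + 1}⟩
  associator A B C :=
    isoOfLIE (A := dsum (dsum A B) C) (B := dsum A (dsum B C))
      (LinearIsometryEquiv.withLpProdAssoc 2 ℂ A B C)
  leftUnitor A :=
    isoOfLIE (A := dsum ⟨PUnit.{u + 1}⟩ A) (B := A)
      (LinearIsometryEquiv.withLpUniqueProd 2 ℂ (PUnit.{u + 1}) A)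
  rightUnitor A :=
    isoOfLIE (A := dsum A ⟨PUnit.{u + 1}⟩) (B := A)
      (LinearIsometryEquiv.withLpProdUnique 2 ℂ A (PUnit.{u + 1}))

noncomputable instance : MonoidalCategory FdHilb.{u} :=
  MonoidalCategory.ofTensorHom
    (id_tensorHom_id := fun _ _ => hom_ext fun _ => rfl)
    (id_tensorHom := fun _ _ _ _ => hom_ext fun _ => rfl)
    (tensorHom_id := fun _ _ => hom_ext fun _ => rfl)
    (tensorHom_comp_tensorHom := fun _ _ _ _ => hom_ext fun _ => rfl)
    (associator_naturality := fun _ _ _ => hom_ext fun _ => rfl)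
    (leftUnitor_naturality := fun _ => hom_ext fun _ => rfl)
    (rightUnitor_naturality := fun _ => hom_ext fun _ => rfl)
    (pentagon := fun _ _ _ _ => hom_ext fun _ => rfl)
    (triangle := fun _ _ => hom_ext fun _ => rfl)

noncomputable instance : BraidedCategory FdHilb.{u} where
  braiding A B :=
    isoOfLIE (A := dsum A B) (B := dsum B A) (LinearIsometryEquiv.withLpProdComm 2 ℂ A B)
  braiding_naturality_left _ _ := hom_ext fun _ => rfl
  braiding_naturality_right _ _ _ _ := hom_ext fun _ => rfl
  hexagon_forward _ _ _ := hom_ext fun _ => rfl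
  hexagon_reverse _ _ _ := hom_ext fun _ => rfl

noncomputable instance : SymmetricCategory FdHilb.{u} where
  symmetry _ _ := hom_ext fun _ => rfl

/-! ### The execution formula -/

/-- The injection `A → A ⊕ B`. -/
noncomputable def inl (A B : FdHilb.{u}) : A ⟶ A ⊗ B :=
  ⟨LinearMap.toContinuousLinearMap
    ((WithLp.linearEquiv 2 ℂ (A × B)).symm.toLinearMap ∘ₗ LinearMap.inl ℂ A B)⟩

/-- The injection `B → A ⊕ B`. -/
noncomputable def inr (A B : FdHilb.{u}) : B ⟶ A ⊗ B :=
  ⟨LinearMap.toContinuousLinearMap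
    ((WithLp.linearEquiv 2 ℂ (A × B)).symm.toLinearMap ∘ₗ LinearMap.inr ℂ A B)⟩

/-- The projection `A ⊕ B → A`. -/
noncomputable def fst (A B : FdHilb.{u}) : A ⊗ B ⟶ A := ⟨WithLp.fstL 2 ℂ A B⟩

/-- The projection `A ⊕ B → B`. -/
noncomputable def snd (A B : FdHilb.{u}) : A ⊗ B ⟶ B := ⟨WithLp.sndL 2 ℂ A B⟩

/-- The family `{f_BA} ⊎ {f_BU f_UU ^ n f_UA}_{n ∈ ℕ}` of the paths of `f : A ⊕ U → B ⊕ U`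
from `A` to `B`. -/
noncomputable def paths {A B U : FdHilb.{u}} (f : A ⊗ U ⟶ B ⊗ U) : Unit ⊕ ℕ → (A →L[ℂ] B) :=
  Sum.elim (fun _ => (inl A U ≫ f ≫ fst B U).toCLM)
    (fun n => (inr A U ≫ f ≫ fst B U).toCLM ∘L ((inr A U ≫ f ≫ snd B U).toCLM ^ n) ∘L
      (inl A U ≫ f ≫ snd B U).toCLM)

/-- The execution formula `ex^U(f) = Σ ({f_BA} ⊎ {f_BU f_UU ^ n f_UA}_{n ∈ ℕ})` in `FdHilb`. It is
defined when the net of all finite partial sums converges in operator norm. -/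
noncomputable def ex {A B U : FdHilb.{u}} (f : A ⊗ U ⟶ B ⊗ U) : Part (A ⟶ B) :=
  ⟨Summable (paths f), fun _ => ⟨∑' i, paths f i⟩⟩

/-! ### Contractions, isometries and unitaries -/

/-- Contractions. -/
def contractions : MorphismProperty FdHilb.{u} := fun _ _ f => ∀ a, ‖f.toCLM a‖ ≤ ‖a‖

/-- Isometries. -/
def isometries : MorphismProperty FdHilb.{u} := fun _ _ f => ∀ a, ‖f.toCLM a‖ = ‖a‖

/-- Unitaries, that is, surjective isometries. -/
def unitaries : MorphismProperty FdHilb.{u} := fun _ _ f =>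
  (∀ a, ‖f.toCLM a‖ = ‖a‖) ∧ Function.Surjective f.toCLM

theorem unitaries_le_isometries : unitaries.{u} ≤ isometries := fun _ _ _ h => h.1

theorem isometries_le_contractions : isometries.{u} ≤ contractions := fun _ _ _ h a => (h a).le

theorem unitaries_le_contractions : unitaries.{u} ≤ contractions :=
  unitaries_le_isometries.trans isometries_le_contractions

theorem isoOfLIE_hom_mem {A B : FdHilb.{u}} (e : A ≃ₗᵢ[ℂ] B) : unitaries (isoOfLIE e).hom :=
  ⟨e.norm_map, e.surjective⟩

theorem isoOfLIE_inv_mem {A B : FdHilb.{u}} (e : A ≃ₗᵢ[ℂ] B) : unitaries (isoOfLIE e).inv :=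
  ⟨e.symm.norm_map, e.symm.surjective⟩

theorem norm_sq_dsum {A B : FdHilb.{u}} (x : dsum A B) : ‖x‖ ^ 2 = ‖x.fst‖ ^ 2 + ‖x.snd‖ ^ 2 :=
  WithLp.prod_norm_sq_eq_of_L2 x

/-- A multiplicative property of morphisms that contains all unitaries and is closed under direct
sums defines a symmetric monoidal wide subcategory. -/
theorem isStableUnderBraiding_of_unitaries_le {P : MorphismProperty FdHilb.{u}} [P.IsMultiplicative]
    (hP : unitaries ≤ P)
    (h : ∀ {A B C D : FdHilb.{u}} (f : A ⟶ C) (g : B ⟶ D), P f → P g → P (f ⊗ₘ g)) :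
    P.IsStableUnderBraiding where
  toIsMonoidal := MorphismProperty.IsMonoidal.mk' _ h
  associator_hom_mem _ _ _ := hP _ (isoOfLIE_hom_mem _)
  associator_inv_mem _ _ _ := hP _ (isoOfLIE_inv_mem _)
  leftUnitor_hom_mem _ := hP _ (isoOfLIE_hom_mem _)
  leftUnitor_inv_mem _ := hP _ (isoOfLIE_inv_mem _)
  rightUnitor_hom_mem _ := hP _ (isoOfLIE_hom_mem _)
  rightUnitor_inv_mem _ := hP _ (isoOfLIE_inv_mem _)
  braiding_hom_mem _ _ := hP _ (isoOfLIE_hom_mem _)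
  braiding_inv_mem _ _ := hP _ (isoOfLIE_inv_mem _)

instance : contractions.{u}.IsMultiplicative where
  id_mem _ _ := le_rfl
  comp_mem _ _ hf hg a := (hg _).trans (hf a)

instance : isometries.{u}.IsMultiplicative where
  id_mem _ _ := rfl
  comp_mem _ _ hf hg a := (hg _).trans (hf a)

instance : unitaries.{u}.IsMultiplicative where
  id_mem _ := ⟨fun _ => rfl, Function.surjective_id⟩
  comp_mem _ _ hf hg := ⟨fun a => (hg.1 _).trans (hf.1 a), hg.2.comp hf.2⟩

theorem contractions_tensorHom {A B C D : FdHilb.{u}} (f : A ⟶ C) (g : B ⟶ D)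
    (hf : contractions f) (hg : contractions g) : contractions (f ⊗ₘ g) := by
  intro (x : dsum A B)
  have h1 : ‖(f ⊗ₘ g).toCLM x‖ ^ 2 = ‖f.toCLM x.fst‖ ^ 2 + ‖g.toCLM x.snd‖ ^ 2 :=
    norm_sq_dsum (A := C) (B := D) _
  have h2 : ‖x‖ ^ 2 = ‖x.fst‖ ^ 2 + ‖x.snd‖ ^ 2 := norm_sq_dsum x
  have h3 := pow_le_pow_left₀ (norm_nonneg _) (hf x.fst) 2
  have h4 := pow_le_pow_left₀ (norm_nonneg _) (hg x.snd) 2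
  exact le_of_sq_le_sq (by linarith) (norm_nonneg _)

theorem isometries_tensorHom {A B C D : FdHilb.{u}} (f : A ⟶ C) (g : B ⟶ D)
    (hf : isometries f) (hg : isometries g) : isometries (f ⊗ₘ g) := by
  intro (x : dsum A B)
  have h1 : ‖(f ⊗ₘ g).toCLM x‖ ^ 2 = ‖f.toCLM x.fst‖ ^ 2 + ‖g.toCLM x.snd‖ ^ 2 :=
    norm_sq_dsum (A := C) (B := D) _
  have h2 : ‖x‖ ^ 2 = ‖x.fst‖ ^ 2 + ‖x.snd‖ ^ 2 := norm_sq_dsum x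
  rw [hf, hg, ← h2] at h1
  exact (sq_eq_sq₀ (norm_nonneg _) (norm_nonneg _)).1 h1

theorem unitaries_tensorHom {A B C D : FdHilb.{u}} (f : A ⟶ C) (g : B ⟶ D)
    (hf : unitaries f) (hg : unitaries g) : unitaries (f ⊗ₘ g) := by
  refine ⟨isometries_tensorHom f g hf.1 hg.1, fun (y : dsum C D) => ?_⟩
  obtain ⟨a, ha⟩ := hf.2 y.fst
  obtain ⟨b, hb⟩ := hg.2 y.snd
  refine ⟨(WithLp.toLp 2 (a, b) : dsum A B), ?_⟩
  change WithLp.toLp 2 (f.toCLM a, g.toCLM b) = y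
  rw [ha, hb]
  rfl

instance : contractions.{u}.IsStableUnderBraiding :=
  isStableUnderBraiding_of_unitaries_le unitaries_le_contractions contractions_tensorHom

instance : isometries.{u}.IsStableUnderBraiding :=
  isStableUnderBraiding_of_unitaries_le unitaries_le_isometries isometries_tensorHom

instance : unitaries.{u}.IsStableUnderBraiding :=
  isStableUnderBraiding_of_unitaries_le le_rfl unitaries_tensorHom

end FdHilb

/-- Finite-dimensional Hilbert spaces and contractions. -/
abbrev FdContraction : Type (u + 1) := WideSubcategory FdHilb.contractions.{u}

/-- Finite-dimensional Hilbert spaces and isometries. -/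
abbrev FdIsometry : Type (u + 1) := WideSubcategory FdHilb.isometries.{u}

/-- Finite-dimensional Hilbert spaces and unitaries. -/
abbrev FdUnitary : Type (u + 1) := WideSubcategory FdHilb.unitaries.{u}

/-- The execution formula in `FdContraction`: sums of families of contractions are taken in
`FdHilb`, and are defined in `FdContraction` when the result is a contraction. -/
noncomputable def FdContraction.ex {A B U : FdContraction.{u}} (f : A ⊗ U ⟶ B ⊗ U) :
    Part (A ⟶ B) :=
  restrictPart (wideSubcategoryInclusion FdHilb.contractions)
    (FdHilb.ex (A := A.obj) (B := B.obj) (U := U.obj) f.hom)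

/-- The inclusion functor `FdIsometry ↪ FdContraction`. -/
abbrev FdIsometry.toFdContraction : FdIsometry.{u} ⥤ FdContraction.{u} :=
  wideInclusionOfLE FdHilb.isometries_le_contractions

/-- The inclusion functor `FdUnitary ↪ FdContraction`. -/
abbrev FdUnitary.toFdContraction : FdUnitary.{u} ⥤ FdContraction.{u} :=
  wideInclusionOfLE FdHilb.unitaries_le_contractions

/-- `êx^U(f)` is `ex^U(f)` if this is an isometry, and is undefined otherwise. -/
noncomputable def FdIsometry.exHat {A B U : FdIsometry.{u}} (f : A ⊗ U ⟶ B ⊗ U) : Part (A ⟶ B) :=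
  restrictPart FdIsometry.toFdContraction
    (FdContraction.ex (A := FdIsometry.toFdContraction.obj A)
      (B := FdIsometry.toFdContraction.obj B) (U := FdIsometry.toFdContraction.obj U)
      (FdIsometry.toFdContraction.map f))

/-- `êx^U(f)` is `ex^U(f)` if this is unitary, and is undefined otherwise. -/
noncomputable def FdUnitary.exHat {A B U : FdUnitary.{u}} (f : A ⊗ U ⟶ B ⊗ U) : Part (A ⟶ B) :=
  restrictPart FdUnitary.toFdContraction
    (FdContraction.ex (A := FdUnitary.toFdContraction.obj A)
      (B := FdUnitary.toFdContraction.obj B) (U := FdUnitary.toFdContraction.obj U)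
      (FdUnitary.toFdContraction.map f))

/-! ### Summability of the powers of an operator -/

/-! Write `b`, `d`, `c` for `f_BU`, `f_UU`, `f_UA`. The powers of `d` need not be summable, since
`d` may have eigenvalues of modulus 1. Their eigenvectors are sent to 0 by `b`, and their span is
orthogonal to everything reachable from `c`. On the rest of `U` the spectral radius of `d` is below
1, so `∑ ‖d ^ n ∘ c‖` converges (`summable_norm_pow_comp`). Then `w = ∑ d ^ n (c a)` satisfies the
feedback equation `f (a, w) = (ex f a, w)`. For an isometry this equation determines the
`B`-component (`eq_of_toCLM_pair_eq`), whichever `w` is used. Comparing norms shows that `ex f` is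
an isometry, and equality of dimensions makes it surjective in the unitary case. Each trace axiom
reduces to producing a feedback vector. -/

theorem summable_norm_pow_of_spectralRadius_lt_one {R : Type*} [NormedRing R] [NormedAlgebra ℂ R]
    [CompleteSpace R] (a : R) (h : spectralRadius ℂ a < 1) : Summable fun n : ℕ => ‖a ^ n‖ := by
  obtain ⟨r, har, hr⟩ := ENNReal.lt_iff_exists_nnreal_btwn.1 h
  have hr1 : (r : ℝ) < 1 := by exact_mod_cast hr
  refine (summable_geometric_of_lt_one r.2 hr1).of_norm_bounded_eventually_nat ?_
  -- Gelfand's formula and the root test; `n ≠ 0` is needed to undo the `n`-th root.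
  filter_upwards [(spectrum.pow_norm_pow_one_div_tendsto_nhds_spectralRadius a).eventually_lt_const
    har, Filter.eventually_ne_atTop 0] with n hn hn0
  rw [← ENNReal.ofReal_coe_nnreal, ENNReal.ofReal_lt_ofReal_iff_of_nonneg (by positivity)] at hn
  calc ‖‖a ^ n‖‖ = (‖a ^ n‖ ^ (1 / n : ℝ)) ^ n := by
        rw [norm_norm, one_div, Real.rpow_inv_natCast_pow (norm_nonneg _) hn0]
    _ ≤ (r : ℝ) ^ n := pow_le_pow_left₀ (by positivity) hn.le n

/-- In finite dimension the spectrum consists of eigenvalues, and the spectral radius is attained on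
it, so it is strictly below 1. -/
theorem ContinuousLinearMap.summable_norm_pow_of_eigenvalue_norm_lt_one {E : Type*}
    [NormedAddCommGroup E] [NormedSpace ℂ E] [FiniteDimensional ℂ E] (T : E →L[ℂ] E)
    (h : ∀ (μ : ℂ) (x : E), x ≠ 0 → T x = μ • x → ‖μ‖ < 1) : Summable fun n : ℕ => ‖T ^ n‖ := by
  have : CompleteSpace E := FiniteDimensional.complete ℂ E
  rcases subsingleton_or_nontrivial E with _ | _
  · have hT : ∀ n : ℕ, ‖T ^ n‖ = 0 := fun n => by
      rw [Subsingleton.elim (T ^ n) 0, norm_zero]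
    simpa only [hT] using summable_zero
  refine summable_norm_pow_of_spectralRadius_lt_one T ?_
  have key := spectrum.spectralRadius_lt_of_forall_lt T (r := 1) fun μ hμ => ?_
  · exact_mod_cast key
  rw [ContinuousLinearMap.spectrum_eq, ← Module.End.hasEigenvalue_iff_mem_spectrum] at hμ
  obtain ⟨x, hx⟩ := hμ.exists_hasEigenvector
  exact_mod_cast h μ x hx.2 hx.apply_eq_smul

/-- If `u ↦ (b u, d u)` is an isometry and `c` takes values orthogonal to `d u` whenever `b u = 0`,
then the operators `d ^ n ∘ c` are absolutely summable. -/
theorem summable_norm_pow_comp {A B U : Type*}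
    [NormedAddCommGroup A] [InnerProductSpace ℂ A]
    [NormedAddCommGroup B] [InnerProductSpace ℂ B]
    [NormedAddCommGroup U] [InnerProductSpace ℂ U] [FiniteDimensional ℂ U]
    (b : U →L[ℂ] B) (d : U →L[ℂ] U) (c : A →L[ℂ] U)
    (hbd : ∀ u v, inner ℂ (b u) (b v) + inner ℂ (d u) (d v) = inner ℂ u v)
    (hc : ∀ a u, b u = 0 → inner ℂ (d u) (c a) = 0) :
    Summable fun n : ℕ => ‖(d ^ n) ∘L c‖ := by
  have hnorm : ∀ u, ‖b u‖ ^ 2 + ‖d u‖ ^ 2 = ‖u‖ ^ 2 := fun u => by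
    have := hbd u u
    simp only [inner_self_eq_norm_sq_to_K] at this
    exact_mod_cast this
  -- The largest `d`-invariant subspace of `ker b`. There `d` is isometric, hence bijective in
  -- finite dimension; surjectivity is what makes `Kᗮ` invariant under `d` and lets it contain the
  -- range of `c`.
  let K : Submodule ℂ U := ⨅ n : ℕ, LinearMap.ker (b ∘L (d ^ n)).toLinearMap
  have mem_K : ∀ u, u ∈ K ↔ ∀ n : ℕ, b ((d ^ n) u) = 0 := fun u => by
    simp only [K, Submodule.mem_iInf]
    rfl
  have b_K : ∀ u ∈ K, b u = 0 := fun u hu => by simpa using (mem_K u).1 hu 0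
  have d_K : ∀ u ∈ K, d u ∈ K := fun u hu => (mem_K _).2 fun n => by
    simpa [pow_succ] using (mem_K u).1 hu (n + 1)
  have d_K_surj : ∀ u ∈ K, ∃ v ∈ K, d v = u := by
    have hinj : Function.Injective (d.toLinearMap.restrict d_K) := by
      rw [injective_iff_map_eq_zero]
      rintro ⟨u, hu⟩ h
      have hdu : d u = 0 := congrArg Subtype.val h
      have := hnorm u
      rw [hdu, b_K u hu] at this
      have hu0 : u = 0 := by simpa using this.symm
      exact Subtype.ext hu0
    intro u hu
    obtain ⟨v, hv⟩ := LinearMap.injective_iff_surjective.1 hinj ⟨u, hu⟩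
    exact ⟨v, v.2, congrArg Subtype.val hv⟩
  have d_W : ∀ v ∈ Kᗮ, d v ∈ Kᗮ := fun v hv => by
    rw [Submodule.mem_orthogonal] at hv ⊢
    intro u hu
    obtain ⟨u', hu', rfl⟩ := d_K_surj u hu
    simpa [b_K u' hu', hv u' hu'] using hbd u' v
  have c_W : ∀ a, c a ∈ Kᗮ := fun a => by
    rw [Submodule.mem_orthogonal]
    intro u hu
    obtain ⟨u', hu', rfl⟩ := d_K_surj u hu
    exact hc a u' (b_K u' hu')
  let d' : Kᗮ →L[ℂ] Kᗮ := (d ∘L Kᗮ.subtypeL).codRestrict Kᗮ fun v => d_W v v.2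
  let c' : A →L[ℂ] Kᗮ := c.codRestrict Kᗮ c_W
  have hpow : ∀ (n : ℕ) (v : Kᗮ), (((d' ^ n) v : Kᗮ) : U) = (d ^ n) v := fun n => by
    induction n with
    | zero => intro v; rfl
    | succ n ih => intro v; rw [pow_succ, pow_succ]; exact ih (d' v)
  have hcomp : ∀ n : ℕ, (d ^ n) ∘L c = Kᗮ.subtypeL ∘L (d' ^ n) ∘L c' := fun n =>
    ContinuousLinearMap.ext fun a => (hpow n (c' a)).symm
  have hsum : Summable fun n : ℕ => ‖d' ^ n‖ := by
    refine d'.summable_norm_pow_of_eigenvalue_norm_lt_one fun μ x hx hμ => ?_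
    -- An eigenvector with `1 ≤ ‖μ‖` leaves no norm for `b x`, so it lies in `K` as well as in `Kᗮ`,
    -- and vanishes.
    by_contra! h1
    have hdx : d x = μ • (x : U) := congrArg Subtype.val hμ
    have hbx : b x = 0 := by
      have h2 := hnorm x
      rw [hdx, norm_smul, mul_pow] at h2
      have h3 : 1 ≤ ‖μ‖ ^ 2 := one_le_pow₀ h1
      have h4 : ‖b x‖ ^ 2 ≤ 0 := by nlinarith [sq_nonneg ‖(x : U)‖]
      simpa using h4.antisymm (sq_nonneg _)
    have hdn : ∀ n : ℕ, (d ^ n) (x : U) = μ ^ n • (x : U) := fun n => by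
      induction n with
      | zero => simp
      | succ n ih =>
        rw [pow_succ', mul_apply_eq_comp, ih, map_smul, hdx, smul_smul, ← pow_succ]
    have hxK : (x : U) ∈ K := (mem_K _).2 fun n => by rw [hdn, map_smul, hbx, smul_zero]
    exact hx (Subtype.ext (inner_self_eq_zero.1 ((Submodule.mem_orthogonal _ _).1 x.2 x hxK)))
  refine ((hsum.mul_left ‖Kᗮ.subtypeL‖).mul_right ‖c'‖).of_nonneg_of_le
    (fun _ => norm_nonneg _) fun n => ?_
  rw [hcomp, mul_assoc]
  exact (ContinuousLinearMap.opNorm_comp_le _ _).trans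
    (mul_le_mul_of_nonneg_left (ContinuousLinearMap.opNorm_comp_le _ _) (norm_nonneg _))

/-- The vector `w = ∑ d ^ n (c a)` works: splitting off its term `n = 0` gives the fixed-point
equation. -/
theorem exists_fixedPoint_of_summable_norm_pow_comp {A B U : Type*}
    [NormedAddCommGroup A] [NormedSpace ℂ A] [NormedAddCommGroup B] [NormedSpace ℂ B]
    [NormedAddCommGroup U] [NormedSpace ℂ U] [CompleteSpace U]
    (b : U →L[ℂ] B) (d : U →L[ℂ] U) (c : A →L[ℂ] U)
    (hs : Summable fun n : ℕ => ‖(d ^ n) ∘L c‖) (a : A) :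
    ∃ w, c a + d w = w ∧ (∑' n : ℕ, b ∘L (d ^ n) ∘L c) a = b w := by
  have hsa : Summable fun n : ℕ => (d ^ n) (c a) := by
    simpa only [ContinuousLinearMap.apply_apply, ContinuousLinearMap.comp_apply] using
      (ContinuousLinearMap.apply ℂ U a).summable hs.of_norm
  have hsb : Summable fun n : ℕ => b ∘L (d ^ n) ∘L c := by
    simpa only [ContinuousLinearMap.compL_apply] using
      (ContinuousLinearMap.compL ℂ A U B b).summable hs.of_norm
  refine ⟨∑' n : ℕ, (d ^ n) (c a), ?_, ?_⟩
  · rw [d.map_tsum hsa, hsa.tsum_eq_zero_add, pow_zero, one_apply_eq_self]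
    simp only [pow_succ', mul_apply_eq_comp]
  · rw [b.map_tsum hsa, ← ContinuousLinearMap.apply_apply (𝕜 := ℂ) a,
      (ContinuousLinearMap.apply ℂ B a).map_tsum hsb]
    simp only [ContinuousLinearMap.apply_apply, ContinuousLinearMap.comp_apply]

/-! ### The execution formula at an isometry, via the feedback equation -/

namespace FdHilb

/-- The element `(a, b)` of `A ⊕ B`. -/
def pair {A B : FdHilb.{u}} (a : A) (b : B) : (A ⊗ B : FdHilb.{u}) :=
  (WithLp.toLp 2 (a, b) : dsum A B)

theorem exists_eq_pair {A B : FdHilb.{u}} (x : (A ⊗ B : FdHilb.{u})) :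
    ∃ a b, x = pair a b :=
  ⟨WithLp.fst (show dsum A B from x), WithLp.snd (show dsum A B from x), rfl⟩

theorem pair_inj {A B : FdHilb.{u}} {a a' : A} {b b' : B} (h : pair a b = pair a' b') :
    a = a' ∧ b = b' :=
  ⟨congrArg (fun x : dsum A B => x.fst) h, congrArg (fun x : dsum A B => x.snd) h⟩

theorem pair_sub {A B : FdHilb.{u}} (a a' : A) (b b' : B) :
    pair a b - pair a' b' = pair (a - a') (b - b') := rfl

theorem pair_add {A B : FdHilb.{u}} (a a' : A) (b b' : B) :
    pair a b + pair a' b' = pair (a + a') (b + b') := rfl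

theorem norm_sq_pair {A B : FdHilb.{u}} (a : A) (b : B) :
    ‖pair a b‖ ^ 2 = ‖a‖ ^ 2 + ‖b‖ ^ 2 :=
  norm_sq_dsum (A := A) (B := B) _

theorem inner_pair {A B : FdHilb.{u}} (a a' : A) (b b' : B) :
    inner ℂ (pair a b) (pair a' b') = inner ℂ a a' + inner ℂ b b' :=
  WithLp.prod_inner_apply (𝕜 := ℂ) (E := A) (F := B) _ _

theorem inner_map_map {A B : FdHilb.{u}} {f : A ⟶ B} (hf : isometries f) (x y : A) :
    inner ℂ (f.toCLM x) (f.toCLM y) = inner ℂ x y :=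
  (LinearMap.norm_map_iff_inner_map_map f.toCLM).1 hf x y

theorem toCLM_pair {A B U : FdHilb.{u}} (f : A ⊗ U ⟶ B ⊗ U) (a : A) (w : U) :
    f.toCLM (pair a w) =
      pair ((inl A U ≫ f ≫ fst B U).toCLM a + (inr A U ≫ f ≫ fst B U).toCLM w)
        ((inl A U ≫ f ≫ snd B U).toCLM a + (inr A U ≫ f ≫ snd B U).toCLM w) := by
  have h : pair a w = (inl A U).toCLM a + (inr A U).toCLM w := by
    change _ = pair a 0 + pair 0 w
    rw [pair_add, add_zero, zero_add]
  rw [h, map_add]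
  rfl

theorem toCLM_pair_zero_left {A B U : FdHilb.{u}} (f : A ⊗ U ⟶ B ⊗ U) (w : U) :
    f.toCLM (pair 0 w) =
      pair ((inr A U ≫ f ≫ fst B U).toCLM w) ((inr A U ≫ f ≫ snd B U).toCLM w) := by
  rw [toCLM_pair, map_zero, map_zero, zero_add, zero_add]

theorem toCLM_pair_zero_right {A B U : FdHilb.{u}} (f : A ⊗ U ⟶ B ⊗ U) (a : A) :
    f.toCLM (pair a 0) =
      pair ((inl A U ≫ f ≫ fst B U).toCLM a) ((inl A U ≫ f ≫ snd B U).toCLM a) := by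
  rw [toCLM_pair, map_zero, map_zero, add_zero, add_zero]

/-- The two conditions of `summable_norm_pow_comp` say that `f` preserves inner products within `0 ⊕
U`, and between `0 ⊕ U` and `A ⊕ 0`. -/
theorem summable_norm_loops {A B U : FdHilb.{u}} {f : A ⊗ U ⟶ B ⊗ U} (hf : isometries f) :
    Summable fun n : ℕ => ‖((inr A U ≫ f ≫ snd B U).toCLM ^ n) ∘L
      (inl A U ≫ f ≫ snd B U).toCLM‖ := by
  refine summable_norm_pow_comp (inr A U ≫ f ≫ fst B U).toCLM _ _ (fun x y => ?_)
    fun a x hx => ?_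
  · have h := inner_map_map hf (pair 0 x) (pair 0 y)
    rwa [toCLM_pair_zero_left, toCLM_pair_zero_left, inner_pair, inner_pair, inner_zero_left,
      zero_add] at h
  · have h := inner_map_map hf (pair 0 x) (pair a 0)
    rwa [toCLM_pair_zero_left, toCLM_pair_zero_right, inner_pair, inner_pair, inner_zero_left,
      inner_zero_right, zero_add, hx, inner_zero_left, zero_add] at h

theorem summable_paths {A B U : FdHilb.{u}} {f : A ⊗ U ⟶ B ⊗ U} (hf : isometries f) :
    Summable (paths f) := by
  refine Summable.sum _ ((hasSum_fintype _).summable) ?_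
  have : CompleteSpace B := FiniteDimensional.complete ℂ B
  exact .of_norm_bounded ((summable_norm_loops hf).mul_left _) fun n =>
    ContinuousLinearMap.opNorm_comp_le _ _

/-- The value of the execution formula at an isometry. -/
noncomputable def exSum {A B U : FdHilb.{u}} (f : A ⊗ U ⟶ B ⊗ U) : A ⟶ B :=
  ⟨∑' i, paths f i⟩

theorem exSum_mem_ex {A B U : FdHilb.{u}} {f : A ⊗ U ⟶ B ⊗ U} (hf : isometries f) :
    exSum f ∈ ex f :=
  ⟨summable_paths hf, rfl⟩

theorem exSum_toCLM {A B U : FdHilb.{u}} {f : A ⊗ U ⟶ B ⊗ U} (hf : isometries f) :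
    (exSum f).toCLM = (inl A U ≫ f ≫ fst B U).toCLM +
      ∑' n : ℕ, (inr A U ≫ f ≫ fst B U).toCLM ∘L ((inr A U ≫ f ≫ snd B U).toCLM ^ n) ∘L
        (inl A U ≫ f ≫ snd B U).toCLM := by
  have h : HasSum (paths f ∘ Sum.inl) (inl A U ≫ f ≫ fst B U).toCLM := by
    have h1 := hasSum_fintype (paths f ∘ Sum.inl)
    rwa [Fintype.sum_unique] at h1
  exact (HasSum.sum h ((summable_paths hf).comp_injective Sum.inr_injective).hasSum).tsum_eq

/-- The execution formula is computed by feeding the output in `U` back into the input. -/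
theorem exists_toCLM_pair_eq {A B U : FdHilb.{u}} {f : A ⊗ U ⟶ B ⊗ U} (hf : isometries f) (a : A) :
    ∃ w : U, f.toCLM (pair a w) = pair ((exSum f).toCLM a) w := by
  have : CompleteSpace U := FiniteDimensional.complete ℂ U
  obtain ⟨w, hw, hbw⟩ := exists_fixedPoint_of_summable_norm_pow_comp
    (inr A U ≫ f ≫ fst B U).toCLM _ _ (summable_norm_loops hf) a
  refine ⟨w, ?_⟩
  rw [toCLM_pair, hw, ← hbw, exSum_toCLM hf]
  rfl

/-- Subtracting gives `f (0, w - w') = (b - b', w - w')`, and equality of norms forces `b = b'`. The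
vectors `w` and `w'` may differ. -/
theorem eq_of_toCLM_pair_eq {A B U : FdHilb.{u}} {f : A ⊗ U ⟶ B ⊗ U} (hf : isometries f) {a : A}
    {b b' : B} {w w' : U} (h : f.toCLM (pair a w) = pair b w)
    (h' : f.toCLM (pair a w') = pair b' w') : b = b' := by
  have h1 := congrArg (‖·‖ ^ 2) (congrArg₂ (· - ·) h h')
  simp only [← map_sub, pair_sub, hf _, norm_sq_pair, sub_self, norm_zero] at h1
  have h2 : ‖b - b'‖ ^ 2 = 0 := by linarith
  exact sub_eq_zero.1 (by simpa using h2)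

theorem exSum_apply {A B U : FdHilb.{u}} {f : A ⊗ U ⟶ B ⊗ U} (hf : isometries f) {a : A}
    {b : B} {w : U} (h : f.toCLM (pair a w) = pair b w) : (exSum f).toCLM a = b :=
  eq_of_toCLM_pair_eq hf (exists_toCLM_pair_eq hf a).choose_spec h

theorem isometries_exSum {A B U : FdHilb.{u}} {f : A ⊗ U ⟶ B ⊗ U} (hf : isometries f) :
    isometries (exSum f) := fun a => by
  obtain ⟨w, hw⟩ := exists_toCLM_pair_eq hf a
  have h := congrArg (‖·‖ ^ 2) hw
  simp only [hf _, norm_sq_pair, add_left_inj] at h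
  exact ((sq_eq_sq₀ (norm_nonneg _) (norm_nonneg _)).1 h).symm

theorem finrank_tensorObj (A B : FdHilb.{u}) :
    Module.finrank ℂ (A ⊗ B : FdHilb.{u}) = Module.finrank ℂ A + Module.finrank ℂ B :=
  (WithLp.linearEquiv 2 ℂ (A × B)).finrank_eq.trans Module.finrank_prod

theorem injective_of_isometries {A B : FdHilb.{u}} {f : A ⟶ B} (hf : isometries f) :
    Function.Injective f.toCLM := by
  rw [injective_iff_map_eq_zero]
  exact fun a ha => norm_eq_zero.1 (by rw [← hf a, ha, norm_zero])

/-- Cancelling `dim U` gives `dim A = dim B`, so the injective map `exSum f` is onto. -/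
theorem unitaries_exSum {A B U : FdHilb.{u}} {f : A ⊗ U ⟶ B ⊗ U} (hf : unitaries f) :
    unitaries (exSum f) := by
  have h : isometries (exSum f) := isometries_exSum hf.1
  have h1 := (LinearEquiv.ofBijective f.toCLM.toLinearMap ⟨injective_of_isometries hf.1, hf.2⟩).finrank_eq
  rw [finrank_tensorObj, finrank_tensorObj, add_left_inj] at h1
  exact ⟨h, (LinearMap.injective_iff_surjective_of_finrank_eq_finrank
    (f := (exSum f).toCLM.toLinearMap) h1).1 (injective_of_isometries h)⟩

/-! ### The trace axioms -/

section WideSubcategory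

variable (P : MorphismProperty FdHilb.{u}) [P.IsStableUnderBraiding]

/-- The trace on a symmetric monoidal subcategory that is closed under the execution formula. -/
noncomputable def trace
    (hex : ∀ {A B U : FdHilb.{u}} (f : A ⊗ U ⟶ B ⊗ U), P f → P (exSum f))
    {A B U : WideSubcategory P} (f : A ⊗ U ⟶ B ⊗ U) : A ⟶ B :=
  ⟨exSum (A := A.obj) (B := B.obj) (U := U.obj) f.hom, hex _ f.property⟩

/-- For each axiom, a feedback vector for one side is turned into one for the other, and
`exSum_apply` reads off the value. -/
theorem isTrace_trace (hP : P ≤ isometries)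
    (hex : ∀ {A B U : FdHilb.{u}} (f : A ⊗ U ⟶ B ⊗ U), P f → P (exSum f)) :
    IsTrace (C := WideSubcategory P) (trace P hex) where
  naturality {A A' B B' U} f g h := by
    refine WideSubcategory.hom_ext P (hom_ext fun a => ?_)
    obtain ⟨w, hw⟩ := exists_toCLM_pair_eq (hP _ f.property) (g.hom.toCLM a)
    exact (exSum_apply (hP _ ((g ⊗ₘ 𝟙 U) ≫ f ≫ (h ⊗ₘ 𝟙 U)).property) (w := w)
      (congrArg (h.hom ⊗ₘ 𝟙 U.obj).toCLM hw)).symm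
  dinaturality {A B U U'} f g := by
    refine WideSubcategory.hom_ext P (hom_ext fun a => ?_)
    obtain ⟨w, hw⟩ := exists_toCLM_pair_eq (hP _ ((𝟙 A ⊗ₘ g) ≫ f).property) a
    -- From `f (a, g w) = (b, w)`, applying `g` to the second component shows that `g w` is a
    -- feedback vector for the other side.
    exact exSum_apply (hP _ (f ≫ (𝟙 B ⊗ₘ g)).property) (w := g.hom.toCLM w)
      (congrArg (𝟙 B.obj ⊗ₘ g.hom).toCLM hw)
  superposing {A B C' D U} f g := by
    refine WideSubcategory.hom_ext P (hom_ext fun x => ?_)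
    obtain ⟨c, a, rfl⟩ := exists_eq_pair x
    obtain ⟨w, hw⟩ := exists_toCLM_pair_eq (hP _ f.property) a
    exact (exSum_apply (hP _ ((α_ C' A U).hom ≫ (g ⊗ₘ f) ≫ (α_ D B U).inv).property)
      (a := pair c a) (b := pair (g.hom.toCLM c) ((exSum f.hom).toCLM a)) (w := w)
      (congrArg (fun y => (α_ D.obj B.obj U.obj).inv.toCLM (pair (g.hom.toCLM c) y)) hw)).symm
  vanishing_one {A B} f := by
    refine WideSubcategory.hom_ext P (hom_ext fun a => ?_)
    obtain ⟨b, w, hw⟩ := exists_eq_pair (f.hom.toCLM (pair a PUnit.unit))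
    refine (exSum_apply (hP _ f.property) hw).trans ?_
    exact (congrArg (ρ_ B.obj).hom.toCLM hw).symm
  vanishing_two {A B U V} f := by
    refine WideSubcategory.hom_ext P (hom_ext fun a => ?_)
    obtain ⟨x, hx⟩ := exists_toCLM_pair_eq (hP _ f.property) a
    -- The feedback vector in `U ⊕ V` splits: `v` serves the inner trace and `w` the outer one.
    obtain ⟨w, v, rfl⟩ := exists_eq_pair x
    refine exSum_apply (hP _ (trace P hex ((α_ A U V).hom ≫ f ≫ (α_ B U V).inv)).property) (w := w)
      (exSum_apply (hP _ ((α_ A U V).hom ≫ f ≫ (α_ B U V).inv).property) (w := v) ?_)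
    exact congrArg (α_ B.obj U.obj V.obj).inv.toCLM hx
  yanking U := by
    refine WideSubcategory.hom_ext P (hom_ext fun a => ?_)
    exact exSum_apply (hP _ (β_ U U).hom.property) (w := a) rfl

end WideSubcategory

end FdHilb

theorem mainTheorem3 :
    IsTotallyTraced FdIsometry.{u} FdIsometry.exHat ∧
      IsTotallyTraced FdUnitary.{u} FdUnitary.exHat := by
  refine ⟨⟨FdHilb.trace FdHilb.isometries fun _ => FdHilb.isometries_exSum,
      FdHilb.isTrace_trace _ le_rfl _, fun f => ?_⟩,
    ⟨FdHilb.trace FdHilb.unitaries fun _ => FdHilb.unitaries_exSum,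
      FdHilb.isTrace_trace _ FdHilb.unitaries_le_isometries _, fun f => ?_⟩⟩
  -- The two restrictions peeled off are to isometries and to contractions, leaving membership in
  -- `FdHilb.ex`.
  · refine Part.eq_some_iff.2 ((mem_restrictPart _ _ _).2 ((mem_restrictPart _ _ _).2 ?_))
    exact FdHilb.exSum_mem_ex f.property
  · refine Part.eq_some_iff.2 ((mem_restrictPart _ _ _).2 ((mem_restrictPart _ _ _).2 ?_))
    exact FdHilb.exSum_mem_ex f.property.1
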